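/- Let $n\ge 2$. Identify $\mathbb R^{2n}$ with $\mathbb C^n$ with its Euclidean norm $|\cdot|$. For $\xi\in\mathbb C^n$ with $|\xi|=1$ let $H_\xi=\{z\in\mathbb C^n:\sum_{k=1}^n z_k\overline{\xi_k}=0\}$. A convex body (compact convex set) $K\subset\mathbb R^{2n}$ with the origin in its interior and with Minkowski functional $\|\cdot\|_K$ is called $R_\theta$-invariant if $\|e^{i\theta}z\|_K=\|z\|_K$ for all $z\in\mathbb C^n$ and all $\theta\in[0,2\pi]$. In the ball model of the complex hyperbolic space $\mathbb H^n_{\mathbb C}$, for a convex body $K$ contained in the open unit ball, put $$\mathrm{HVol}_{2n}(K)=8^n\int_K\frac{dx}{(1-|x|^2)^{n+1}},\qquad \mathrm{HVol}_{2n-2}(K\cap H_\xi)=8^{n-1}\int_{K\cap H_\xi}\frac{dx}{(1-|x|^2)^{n}},$$ where $dx$ is Lebesgue measure on $\mathbb R^{2n}$ and on the $(2n-2)$-dimensional real subspace $H_\xi$, respectively. (a) If $n=2$, then for all $R_\theta$-invariant convex bodies $K,L$ in $\mathbb R^{2n}$ that have the origin in their interior and are contained in the open unit ball, if $\mathrm{HVol}_{2n-2}(K\cap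 H_\xi)\le \mathrm{HVol}_{2n-2}(L\cap H_\xi)$ for every $\xi\in\mathbb C^n$ with $|\xi|=1$, then $\mathrm{HVol}_{2n}(K)\le \mathrm{HVol}_{2n}(L)$. (b) For every $n\ge 3$ there exist $R_\theta$-invariant convex bodies $K,L$ in $\mathbb R^{2n}$, having the origin in their interior and contained in the open unit ball, such that $\mathrm{HVol}_{2n-2}(K\cap H_\xi)\le \mathrm{HVol}_{2n-2}(L\cap H_\xi)$ for every $\xi\in\mathbb C^n$ with $|\xi|=1$, but $\mathrm{HVol}_{2n}(K)>\mathrm{HVol}_{2n}(L)$. -/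

import Mathlib

open MeasureTheory Metric

noncomputable section

/-- The volume of the ball model of complex hyperbolic `m`-space, on a real inner product space `E`
of dimension `2 * m`: the measure on the open unit ball of `E` with density
`8 ^ m / (1 - |x| ^ 2) ^ (m + 1)` with respect to Lebesgue measure; in polar coordinates,
`8 ^ m * r ^ (2 * m - 1) / (1 - r ^ 2) ^ (m + 1) dr dσ`. -/
def complexHyperbolicVolume (m : ℕ) (E : Type*) [NormedAddCommGroup E] [InnerProductSpace ℝ E]
    [FiniteDimensional ℝ E] [MeasurableSpace E] [BorelSpace E] : Measure E :=
  ((volume : Measure E).restrict (ball 0 1)).withDensity fun x =>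
    ENNReal.ofReal (8 ^ m / (1 - ‖x‖ ^ 2) ^ (m + 1))

/-- The complex hyperplane `H_ξ = {z | ∑ z_k * conj ξ_k = 0}` through the origin, as a real
subspace; for `ξ ≠ 0` it has real dimension `2 * (n - 1)`. -/
def complexHyperplane {n : ℕ} (ξ : EuclideanSpace ℂ (Fin n)) :
    Submodule ℝ (EuclideanSpace ℂ (Fin n)) :=
  ((Submodule.span ℂ {ξ})ᗮ).restrictScalars ℝ

/-- `HVol_{2n}(A)`, with `ℝ^{2n}` identified with `ℂ^n`. -/
def HVol {n : ℕ} (A : Set (EuclideanSpace ℂ (Fin n))) : ENNReal :=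
  complexHyperbolicVolume n (EuclideanSpace ℂ (Fin n)) A

/-- `HVol_{2n-2}(A ∩ H_ξ)` for `ξ ≠ 0` (hence `n ≥ 1`): the volume of the section in the ball model
of complex hyperbolic `(n-1)`-space carried by the unit ball of `H_ξ`. -/
def sectionHVol {n : ℕ} (A : Set (EuclideanSpace ℂ (Fin n))) (ξ : EuclideanSpace ℂ (Fin n)) :
    ENNReal :=
  complexHyperbolicVolume (n - 1) (complexHyperplane ξ)
    {x | (x : EuclideanSpace ℂ (Fin n)) ∈ A}

/-- The convex body `K` (compact, convex) has the origin in its interior, its Minkowski functional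
is invariant under simultaneous rotation of all complex coordinates by any angle, and it is
contained in the open unit ball. -/
structure IsInvariantBodyInBall {n : ℕ} (K : ConvexBody (EuclideanSpace ℂ (Fin n))) : Prop where
  zero_mem_interior : 0 ∈ interior (K : Set (EuclideanSpace ℂ (Fin n)))
  rotation_invariant : ∀ θ ∈ Set.Icc (0 : ℝ) (2 * Real.pi), ∀ ξ : EuclideanSpace ℂ (Fin n),
    gauge (K : Set (EuclideanSpace ℂ (Fin n))) (Complex.exp (θ * Complex.I) • ξ) =
      gauge (K : Set (EuclideanSpace ℂ (Fin n))) ξ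
  subset_ball : (K : Set (EuclideanSpace ℂ (Fin n))) ⊆ ball 0 1

end

/-! For `n = 2` the hyperplane `H_ξ` is a complex line and an invariant body meets it in a disc
centred at the origin. Comparing the areas of concentric discs compares their radii, so the
hypothesis already gives `K ⊆ L` (`subset_of_sectionHVol_le`).

For `n ≥ 3` put `m = n - 1` and describe a body by its squared gauge `‖x‖ ^ 2 * (1 + φ x)`. With `ρ`
its radial function, `ρ ^ 2 / (1 - ρ ^ 2) = 1 / φ`, and the radial density integrates exactly to a
multiple of the corresponding power of this quotient (`complexHyperbolicVolume_star`). Choosing `φ =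
ε * W ^ (-1/m)`, with `W` a function of `t = ‖θ i‖ ^ 2`, makes section volumes linear in `W`, while
the full volume is a multiple of `∫ W ^ (n/m)` (`exists_convexBody_volumes`). Small `ε` makes the
body a `C²`-small perturbation of the ball, hence convex (`convex_setOf_norm_sq_mul_le`).

Take `W = g ^ m` for `L` and `W = g ^ m + l * (m * t - 1)` for `K`. On the unit sphere of any `H_ξ`
the mean of `t` is at most `1 / m` (`integral_section_coord_le`), so no section of `K` exceeds that
of `L`. By Bernoulli's inequality the full integral grows by at least `(n/m) * l * ∫ g * (m * t -
1)`. This is positive once `g` puts enough weight on `t > 1 / m` (`exists_weight`), a region that is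
nonempty exactly because `m ≥ 2`. -/

/-- The surface measure on the unit sphere of a Euclidean space. -/
noncomputable def sphereMeasure (E : Type*) [NormedAddCommGroup E] [InnerProductSpace ℝ E]
    [FiniteDimensional ℝ E] [MeasurableSpace E] [BorelSpace E] : Measure (sphere (0 : E) 1) :=
  (volume : Measure E).toSphere

/-! ### Polar coordinates and hyperbolic volumes of star bodies. -/

/-- Integration in polar coordinates. -/
lemma lintegral_eq_lintegral_toSphere {E : Type*} [NormedAddCommGroup E] [NormedSpace ℝ E]
    [FiniteDimensional ℝ E] [MeasurableSpace E] [BorelSpace E] [Nontrivial E]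
    (μ : Measure E) [μ.IsAddHaarMeasure] {f : E → ENNReal} (hf : Measurable f) :
    ∫⁻ x, f x ∂μ = ∫⁻ θ : sphere (0 : E) 1, (∫⁻ r in Set.Ioi (0 : ℝ),
      ENNReal.ofReal (r ^ (Module.finrank ℝ E - 1)) * f (r • (θ : E))) ∂μ.toSphere := by
  have hF : Measurable fun q : sphere (0 : E) 1 × Set.Ioi (0 : ℝ) => f ((q.2 : ℝ) • (q.1 : E)) := by
    fun_prop
  calc
    ∫⁻ x, f x ∂μ = ∫⁻ x : ({(0)}ᶜ : Set E), f x ∂(μ.comap (↑)) := by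
      rw [lintegral_subtype_comap (measurableSet_singleton _).compl f, restrict_compl_singleton]
    _ = ∫⁻ q, f ((q.2 : ℝ) • (q.1 : E)) ∂μ.toSphere.prod
          (.volumeIoiPow (Module.finrank ℝ E - 1)) := by
      rw [← μ.measurePreserving_homeomorphUnitSphereProd.lintegral_comp hF]
      refine lintegral_congr fun x => ?_
      have hx : ‖(x : E)‖ ≠ 0 := norm_ne_zero_iff.2 x.2
      simp [hx]
    _ = _ := by
      rw [lintegral_prod _ hF.aemeasurable]
      refine lintegral_congr fun θ => ?_
      rw [Measure.volumeIoiPow, lintegral_withDensity_eq_lintegral_mul _ (by fun_prop) (by fun_prop),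
        ← lintegral_subtype_comap measurableSet_Ioi]
      rfl

/-- The hyperbolic radial density has the primitive `8 ^ m / (2 m) * (r ^ 2 / (1 - r ^ 2)) ^ m`. -/
lemma hasDerivAt_hyperbolicRadial {m : ℕ} (hm : 1 ≤ m) {r : ℝ} (hr : r ^ 2 < 1) :
    HasDerivAt (fun r : ℝ => 8 ^ m / (2 * m) * (r ^ 2 / (1 - r ^ 2)) ^ m)
      (r ^ (2 * m - 1) * (8 ^ m / (1 - r ^ 2) ^ (m + 1))) r := by
  have h1 : (1 - r ^ 2) ≠ 0 := by linarith
  have h := ((((hasDerivAt_pow 2 r).div ((hasDerivAt_pow 2 r).const_sub 1) h1).pow m).const_mul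
    ((8 : ℝ) ^ m / (2 * m)))
  refine h.congr_deriv ?_
  obtain ⟨k, rfl⟩ : ∃ k, m = k + 1 := ⟨m - 1, by omega⟩
  have e : 2 * (k + 1) - 1 = 2 * k + 1 := by omega
  rw [e]
  simp only [Nat.add_sub_cancel, Pi.div_apply, div_pow]
  push_cast
  have hk : (k : ℝ) + 1 ≠ 0 := by positivity
  field_simp
  simp
  ring

lemma lintegral_hyperbolicRadial {m : ℕ} (hm : 1 ≤ m) {ρ : ℝ} (h0 : 0 ≤ ρ) (h1 : ρ < 1) :
    ∫⁻ r in Set.Ioc 0 ρ, ENNReal.ofReal (r ^ (2 * m - 1)) *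
        ENNReal.ofReal (8 ^ m / (1 - r ^ 2) ^ (m + 1)) =
      ENNReal.ofReal (8 ^ m / (2 * m) * (ρ ^ 2 / (1 - ρ ^ 2)) ^ m) := by
  have hlt : ∀ r ∈ Set.Icc 0 ρ, r ^ 2 < 1 := fun r hr => by nlinarith [hr.1, hr.2]
  have hcont : ContinuousOn (fun r : ℝ => r ^ (2 * m - 1) * (8 ^ m / (1 - r ^ 2) ^ (m + 1)))
      (Set.uIcc 0 ρ) := by
    rw [Set.uIcc_of_le h0]
    refine ContinuousOn.mul (by fun_prop) (ContinuousOn.div (by fun_prop) (by fun_prop) ?_)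
    intro r hr
    have := hlt r hr
    exact pow_ne_zero _ (by linarith)
  have hint := hcont.intervalIntegrable (μ := volume)
  have hftc := intervalIntegral.integral_eq_sub_of_hasDerivAt
    (f := fun r : ℝ => 8 ^ m / (2 * m) * (r ^ 2 / (1 - r ^ 2)) ^ m) (a := 0) (b := ρ)
    (fun r hr => hasDerivAt_hyperbolicRadial hm (hlt r (by rwa [Set.uIcc_of_le h0] at hr))) hint
  have hm' : m ≠ 0 := by omega
  simp only [ne_eq, OfNat.ofNat_ne_zero, not_false_eq_true, zero_pow, zero_div, hm', mul_zero,
    sub_zero] at hftc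
  rw [← hftc, intervalIntegral.integral_of_le h0, ofReal_integral_eq_lintegral_ofReal]
  · refine setLIntegral_congr_fun measurableSet_Ioc fun r hr => ?_
    exact (ENNReal.ofReal_mul (pow_nonneg hr.1.le _)).symm
  · exact (intervalIntegrable_iff_integrableOn_Ioc_of_le h0).1 hint
  · filter_upwards [ae_restrict_mem measurableSet_Ioc] with r hr
    have := hlt r ⟨hr.1.le, hr.2⟩
    have h2 : 0 < 1 - r ^ 2 := by linarith
    have := hr.1
    simp only [Pi.zero_apply]
    positivity

/-- The hyperbolic volume of a star body whose gauge is the square root of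
`‖x‖ ^ 2 * (1 + φ x)`, for `φ` positively homogeneous of degree zero. -/
lemma complexHyperbolicVolume_star {m : ℕ} (hm : 1 ≤ m) {E : Type*} [NormedAddCommGroup E]
    [InnerProductSpace ℝ E] [FiniteDimensional ℝ E] [MeasurableSpace E] [BorelSpace E]
    (hE : Module.finrank ℝ E = 2 * m) {φ : E → ℝ} (hφ : Measurable φ) (hpos : ∀ x, 0 < φ x)
    (hhom : ∀ (r : ℝ) (x : E), 0 < r → φ (r • x) = φ x) :
    complexHyperbolicVolume m E {x | ‖x‖ ^ 2 * (1 + φ x) ≤ 1} =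
      ∫⁻ θ : sphere (0 : E) 1, ENNReal.ofReal (8 ^ m / (2 * m) * (φ θ)⁻¹ ^ m)
        ∂sphereMeasure E := by
  have : Nontrivial E := Module.nontrivial_of_finrank_pos (R := ℝ) (by omega)
  set K : Set E := {x | ‖x‖ ^ 2 * (1 + φ x) ≤ 1} with hKdef
  have hK : MeasurableSet K := measurableSet_le (by fun_prop) measurable_const
  have hKball : K ⊆ ball 0 1 := by
    intro x hx
    have hx' : ‖x‖ ^ 2 * (1 + φ x) ≤ 1 := hx
    rw [mem_ball_zero_iff]
    by_contra! h
    nlinarith [hpos x, mul_le_mul h h zero_le_one (norm_nonneg x)]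
  rw [complexHyperbolicVolume, withDensity_apply _ hK, Measure.restrict_restrict hK,
    Set.inter_eq_left.2 hKball, ← lintegral_indicator hK,
    lintegral_eq_lintegral_toSphere _ ((by fun_prop : Measurable _).indicator hK)]
  refine lintegral_congr fun θ => ?_
  have hθ : ‖(θ : E)‖ = 1 := by simp
  have hp := hpos θ
  -- The radial function of `K` in the direction `θ`; homogeneity of `φ` makes the ray meet `K`
  -- exactly in `r ≤ ρ`.
  set ρ : ℝ := √(1 / (1 + φ θ)) with hρ
  have hρ2 : ρ ^ 2 = 1 / (1 + φ θ) := Real.sq_sqrt (by positivity)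
  have hρ0 : 0 ≤ ρ := Real.sqrt_nonneg _
  have hρ1 : ρ < 1 := by
    rw [hρ, Real.sqrt_lt' one_pos, div_lt_iff₀ (by positivity)]
    linarith
  have hval : ρ ^ 2 / (1 - ρ ^ 2) = (φ θ)⁻¹ := by
    rw [hρ2]
    field_simp
    simp [hp.ne']
  rw [← hval, ← lintegral_hyperbolicRadial hm hρ0 hρ1, hE,
    ← lintegral_indicator measurableSet_Ioi, ← lintegral_indicator measurableSet_Ioc]
  refine lintegral_congr fun r => ?_
  by_cases hr : 0 < r
  · have hmem : r • (θ : E) ∈ K ↔ r ≤ ρ := by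
      rw [hKdef, Set.mem_ofPred_eq, norm_smul, hθ, hhom r _ hr, hρ, Real.le_sqrt hr.le (by positivity),
        le_div_iff₀ (by positivity)]
      simp
    by_cases h : r ≤ ρ
    · have h' := hmem.2 h
      rw [Set.indicator_of_mem (show r ∈ Set.Ioi (0 : ℝ) from hr),
        Set.indicator_of_mem (show r ∈ Set.Ioc 0 ρ from ⟨hr, h⟩), Set.indicator_of_mem h',
        norm_smul, hθ]
      simp
    · have h' := mt hmem.1 h
      rw [Set.indicator_of_mem (show r ∈ Set.Ioi (0 : ℝ) from hr),
        Set.indicator_of_notMem h', mul_zero, Set.indicator_of_notMem fun hh => h hh.2]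
  · rw [Set.indicator_of_notMem (by simpa using hr), Set.indicator_of_notMem (fun hh => hr hh.1)]

/-! ### Symmetry and second moments of the spherical measure. -/

open scoped RealInnerProductSpace

section

variable {E : Type*} [NormedAddCommGroup E] [InnerProductSpace ℝ E]
  [FiniteDimensional ℝ E] [MeasurableSpace E] [BorelSpace E]

instance : IsFiniteMeasure (sphereMeasure E) :=
  inferInstanceAs (IsFiniteMeasure (volume : Measure E).toSphere)

instance : (sphereMeasure E).IsOpenPosMeasure :=
  inferInstanceAs (volume : Measure E).toSphere.IsOpenPosMeasure

/-- The spherical measure is invariant under linear isometries. -/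
lemma integral_sphere_comp_isometry (f : E → ℝ) (e : E ≃ₗᵢ[ℝ] E) :
    ∫ θ : sphere (0 : E) 1, f (e θ) ∂sphereMeasure E =
      ∫ θ : sphere (0 : E) 1, f θ ∂sphereMeasure E := by
  have hmaps : ∀ x : E, x ∈ sphere (0 : E) 1 ↔ e x ∈ sphere (0 : E) 1 := by simp
  let T : sphere (0 : E) 1 ≃ₜ sphere (0 : E) 1 := e.toHomeomorph.subtype hmaps
  have hT : MeasurePreserving T (sphereMeasure E) (sphereMeasure E) := by
    refine ⟨T.measurable, Measure.ext fun s hs => ?_⟩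
    rw [Measure.map_apply T.measurable hs, sphereMeasure, Measure.toSphere_apply' _ (T.measurable hs),
      Measure.toSphere_apply' _ hs]
    congr 1
    refine Eq.trans ?_ (e.measurePreserving.measure_preimage_equiv (f := e.toMeasurableEquiv) _)
    congr 1
    ext x
    simp only [Set.mem_smul, Set.mem_image, Set.mem_preimage, Subtype.exists, exists_and_right,
      exists_eq_right]
    change _ ↔ ∃ r ∈ Set.Ioo (0 : ℝ) 1, ∃ y, (∃ h : y ∈ sphere (0 : E) 1, ⟨y, h⟩ ∈ s) ∧
      r • y = e x
    constructor
    · rintro ⟨r, hr, y, ⟨hy, hys⟩, rfl⟩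
      exact ⟨r, hr, e y, ⟨(hmaps y).1 hy, hys⟩, by simp⟩
    · rintro ⟨r, hr, y, ⟨hy, hys⟩, hx⟩
      refine ⟨r, hr, e.symm y, ⟨(hmaps _).2 (by simpa using hy), ?_⟩, ?_⟩
      · have : T ⟨e.symm y, (hmaps _).2 (by simpa using hy)⟩ = ⟨y, hy⟩ :=
          Subtype.ext (e.apply_symm_apply y)
        rwa [this]
      · apply e.injective
        rw [map_smul, e.apply_symm_apply, hx]
  exact hT.integral_comp T.measurableEmbedding fun θ => f θ

lemma integrable_sphere {f : sphere (0 : E) 1 → ℝ} (hf : Continuous f) :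
    Integrable f (sphereMeasure E) :=
  hf.integrable_of_hasCompactSupport (.of_compactSpace f)

/-- The second moment of the spherical measure in a given direction. -/
lemma integral_sphere_inner_sq (u : E) :
    Module.finrank ℝ E * ∫ θ : sphere (0 : E) 1, ⟪u, (θ : E)⟫ ^ 2 ∂sphereMeasure E =
      ‖u‖ ^ 2 * (sphereMeasure E).real Set.univ := by
  set Q : E → ℝ := fun u => ∫ θ : sphere (0 : E) 1, ⟪u, (θ : E)⟫ ^ 2 ∂sphereMeasure E
    with hQ
  have hnorm : ∀ v w : E, ‖v‖ = ‖w‖ → Q v = Q w := by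
    intro v w h
    -- Vectors of equal norm are exchanged by the reflection in their bisecting hyperplane, so `Q`
    -- depends on the norm only.
    have hr := Submodule.reflection_sub h
    have h2 := integral_sphere_comp_isometry (fun x => ⟪w, x⟫ ^ 2) ((ℝ ∙ (v - w))ᗮ.reflection)
    refine Eq.trans ?_ h2
    refine integral_congr_ae (.of_forall fun θ => ?_)
    simp only
    rw [← LinearIsometryEquiv.inner_map_map ((ℝ ∙ (v - w))ᗮ.reflection) v, hr]
  have hsmul : ∀ (c : ℝ) (v : E), Q (c • v) = c ^ 2 * Q v := by
    intro c v
    simp only [hQ, inner_smul_left, mul_pow, ← integral_const_mul]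
    simp
  let b := stdOrthonormalBasis ℝ E
  have hsum : ∑ i, Q (b i) = (sphereMeasure E).real Set.univ := by
    rw [hQ, ← integral_finsetSum _ fun i _ => integrable_sphere (by fun_prop)]
    have : ∀ θ : sphere (0 : E) 1, ∑ i, ⟪b i, (θ : E)⟫ ^ 2 = 1 := by
      intro θ
      rw [b.sum_sq_inner_right]
      simp
    simp [this]
  have hconst : ∀ i, ‖u‖ ^ 2 * Q (b i) = Q u := by
    intro i
    rw [← hsmul]
    exact hnorm _ _ (by simp [norm_smul])
  rw [← hsum, Finset.mul_sum]
  simp only [hconst, Finset.sum_const, Finset.card_univ, Fintype.card_fin, nsmul_eq_mul]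
  rfl

end

/-! ### Convexity of small perturbations of the ball. -/

/-- For quadratic polynomials `0 ≤ p ≤ P` with `P` nonvanishing on `[0, 1]` and `φ` small in `C²`,
the function `P * (1 + φ (p / P))` is convex on `[0, 1]`. -/
lemma convexOn_mul_one_add_comp_div {φ φ' φ'' : ℝ → ℝ}
    (h1 : ∀ t ∈ Set.Icc (0 : ℝ) 1, HasDerivAt φ (φ' t) t)
    (h2 : ∀ t ∈ Set.Icc (0 : ℝ) 1, HasDerivAt φ' (φ'' t) t)
    (hsmall : ∀ t ∈ Set.Icc (0 : ℝ) 1, |φ t| + |φ' t| + 8 * |φ'' t| ≤ 1)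
    {P p P' p' : ℝ → ℝ} {A a : ℝ} (ha : 0 ≤ a) (haA : a ≤ A)
    (hP : ∀ s, HasDerivAt P (P' s) s) (hP' : ∀ s, HasDerivAt P' (2 * A) s)
    (hp : ∀ s, HasDerivAt p (p' s) s) (hp' : ∀ s, HasDerivAt p' (2 * a) s)
    (hpos : ∀ s ∈ Set.Icc (0 : ℝ) 1, 0 < P s) (hp0 : ∀ s, 0 ≤ p s) (hpP : ∀ s, p s ≤ P s)
    (hPA : ∀ s, P' s ^ 2 ≤ 4 * A * P s) (hpA : ∀ s, p' s ^ 2 ≤ 4 * a * p s) :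
    ConvexOn ℝ (Set.Icc (0 : ℝ) 1) fun s => P s * (1 + φ (p s / P s)) := by
  have hτ : ∀ s ∈ Set.Icc (0 : ℝ) 1, p s / P s ∈ Set.Icc (0 : ℝ) 1 := fun s hs =>
    ⟨div_nonneg (hp0 s) (hpos s hs).le, (div_le_one (hpos s hs)).2 (hpP s)⟩
  have hdτ : ∀ s ∈ Set.Icc (0 : ℝ) 1, HasDerivAt (fun s => p s / P s)
      ((p' s - p s / P s * P' s) / P s) s := by
    intro s hs
    have := (hpos s hs).ne'
    refine ((hp s).fun_div (hP s) this).congr_deriv ?_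
    field_simp
  have hf : ∀ s ∈ Set.Icc (0 : ℝ) 1, HasDerivAt (fun s => P s * (1 + φ (p s / P s)))
      (P' s * (1 + φ (p s / P s)) + φ' (p s / P s) * (p' s - p s / P s * P' s)) s := by
    intro s hs
    have := (hpos s hs).ne'
    refine ((hP s).fun_mul (((h1 _ (hτ s hs)).comp s (hdτ s hs)).const_add 1)).congr_deriv ?_
    simp only [Function.comp_apply]
    field_simp
  have hf' : ∀ s ∈ Set.Icc (0 : ℝ) 1, HasDerivAt
      (fun s => P' s * (1 + φ (p s / P s)) + φ' (p s / P s) * (p' s - p s / P s * P' s))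
      (2 * A * (1 + φ (p s / P s)) + φ' (p s / P s) * (2 * a - p s / P s * (2 * A))
        + φ'' (p s / P s) * ((p' s - p s / P s * P' s) ^ 2 / P s)) s := by
    intro s hs
    have := (hpos s hs).ne'
    refine (((hP' s).fun_mul (((h1 _ (hτ s hs)).comp s (hdτ s hs)).const_add 1)).fun_add
      (((h2 _ (hτ s hs)).comp s (hdτ s hs)).fun_mul
        ((hp' s).fun_sub ((hdτ s hs).fun_mul (hP' s))))).congr_deriv ?_
    simp only [Function.comp_apply]
    field_simp
    ring
  refine convexOn_of_hasDerivWithinAt2_nonneg (convex_Icc 0 1)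
    (fun s hs => (hf s hs).continuousAt.continuousWithinAt)
    (fun s hs => (hf s (interior_subset hs)).hasDerivWithinAt)
    (fun s hs => (hf' s (interior_subset hs)).hasDerivWithinAt) fun s hs => ?_
  have hs := interior_subset hs
  have hPs := hpos s hs
  obtain ⟨ht0, ht1⟩ := hτ s hs
  have hsm := hsmall _ (hτ s hs)
  set t := p s / P s with ht
  have hA : 0 ≤ A := ha.trans haA
  have hpt : p s = t * P s := by rw [ht, div_mul_cancel₀ _ hPs.ne']
  -- The bounds `2 * A` and `16 * A` on the factors of `φ'` and `φ''` make the second derivative at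
  -- least `2 * A * (1 - |φ| - |φ'| - 8 * |φ''|)`; this is the source of the constant `8`.
  have e1 : |2 * a - t * (2 * A)| ≤ 2 * A := by
    rw [abs_le]
    constructor <;> nlinarith
  have e2 : (p' s - t * P' s) ^ 2 / P s ≤ 16 * A := by
    rw [div_le_iff₀ hPs]
    have h3 := hpA s
    have h4 := hPA s
    have h5 : p' s ^ 2 ≤ 4 * A * P s := by
      refine h3.trans ?_
      have := mul_le_mul haA (hpP s) (hp0 s) hA
      linarith
    have h6 : (t * P' s) ^ 2 ≤ 4 * A * P s := by
      have : t ^ 2 ≤ 1 := by nlinarith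
      have : t ^ 2 * P' s ^ 2 ≤ 1 * P' s ^ 2 := by gcongr
      rw [mul_pow]
      linarith
    nlinarith [sq_nonneg (p' s + t * P' s)]
  have e3 : 0 ≤ (p' s - t * P' s) ^ 2 / P s := by positivity
  have g1 : -(|φ t| * (2 * A)) ≤ 2 * A * φ t := by nlinarith [neg_abs_le (φ t)]
  have g2 : -(|φ' t| * (2 * A)) ≤ φ' t * (2 * a - t * (2 * A)) := by
    have := neg_abs_le (φ' t * (2 * a - t * (2 * A)))
    rw [abs_mul] at this
    have := mul_le_mul_of_nonneg_left e1 (abs_nonneg (φ' t))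
    linarith
  have g3 : -(|φ'' t| * (16 * A)) ≤ φ'' t * ((p' s - t * P' s) ^ 2 / P s) := by
    have := neg_abs_le (φ'' t * ((p' s - t * P' s) ^ 2 / P s))
    rw [abs_mul, abs_of_nonneg e3] at this
    have := mul_le_mul_of_nonneg_left e2 (abs_nonneg (φ'' t))
    linarith
  have := mul_le_mul_of_nonneg_left hsm hA
  linarith

section

variable {E F : Type*} [NormedAddCommGroup E] [InnerProductSpace ℝ E] [NormedAddCommGroup F]
  [InnerProductSpace ℝ F]

lemma hasDerivAt_norm_sq_line (x y : E) (s : ℝ) :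
    HasDerivAt (fun s : ℝ => ‖x + s • y‖ ^ 2) (2 * ⟪x + s • y, y⟫) s :=
  ((((hasDerivAt_id s).smul_const y).const_add x).norm_sq).congr_deriv (by simp)

lemma hasDerivAt_inner_line (x y : E) (s : ℝ) :
    HasDerivAt (fun s : ℝ => 2 * ⟪x + s • y, y⟫) (2 * ‖y‖ ^ 2) s := by
  have h := ((((hasDerivAt_id s).smul_const y).const_add x).inner ℝ (hasDerivAt_const s y))
  refine (h.const_mul 2).congr_deriv ?_
  simp

/-- A small `C²` perturbation, depending on the ratio `‖T x‖ ^ 2 / ‖x‖ ^ 2` only, of the unit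
ball is convex. -/
lemma convex_setOf_norm_sq_mul_le {φ φ' φ'' : ℝ → ℝ}
    (h1 : ∀ t ∈ Set.Icc (0 : ℝ) 1, HasDerivAt φ (φ' t) t)
    (h2 : ∀ t ∈ Set.Icc (0 : ℝ) 1, HasDerivAt φ' (φ'' t) t)
    (hsmall : ∀ t ∈ Set.Icc (0 : ℝ) 1, |φ t| + |φ' t| + 8 * |φ'' t| ≤ 1)
    (T : E →ₗ[ℝ] F) (hT : ∀ x, ‖T x‖ ≤ ‖x‖) :
    Convex ℝ {x : E | ‖x‖ ^ 2 * (1 + φ (‖T x‖ ^ 2 / ‖x‖ ^ 2)) ≤ 1} := by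
  set G : E → ℝ := fun x => ‖x‖ ^ 2 * (1 + φ (‖T x‖ ^ 2 / ‖x‖ ^ 2)) with hG
  have hsmul : ∀ (c : ℝ) x, G (c • x) = c ^ 2 * G x := by
    intro c x
    rcases eq_or_ne c 0 with rfl | hc
    · simp [hG]
    · simp only [hG, map_smul, norm_smul, mul_pow, Real.norm_eq_abs, sq_abs]
      rw [mul_div_mul_left _ _ (pow_ne_zero 2 hc), mul_assoc]
  have hstar : ∀ x, G x ≤ 1 → ∀ c ∈ Set.Icc (0 : ℝ) 1, G (c • x) ≤ 1 := by
    intro x hx c hc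
    rw [hsmul]
    have : c ^ 2 ≤ 1 := by nlinarith [hc.1, hc.2]
    nlinarith [sq_nonneg c]
  have key : ∀ x y : E, G x ≤ 1 → G (x + y) ≤ 1 → ∀ s ∈ Set.Icc (0 : ℝ) 1, G (x + s • y) ≤ 1 := by
    intro x y hx hy s hs
    -- The ratio is smooth along the segment only away from the origin. A segment through the origin
    -- needs no derivative: each of its points is an endpoint scaled by a factor in `[0, 1]`.
    by_cases hz : ∀ r ∈ Set.Icc (0 : ℝ) 1, x + r • y ≠ 0
    · have hc := convexOn_mul_one_add_comp_div h1 h2 hsmall (sq_nonneg ‖T y‖)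
        (pow_le_pow_left₀ (norm_nonneg _) (hT y) 2)
        (hasDerivAt_norm_sq_line x y) (hasDerivAt_inner_line x y)
        (hasDerivAt_norm_sq_line (T x) (T y)) (hasDerivAt_inner_line (T x) (T y))
        (fun r hr => by have := norm_pos_iff.2 (hz r hr); positivity)
        (fun r => sq_nonneg _)
        (fun r => by
          rw [← map_smul, ← map_add]
          exact pow_le_pow_left₀ (norm_nonneg _) (hT _) 2)
        (fun r => by
          have := sq_le_sq' (neg_le_of_abs_le (abs_real_inner_le_norm (x + r • y) y))
            (le_of_abs_le (abs_real_inner_le_norm (x + r • y) y))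
          nlinarith)
        (fun r => by
          have := sq_le_sq' (neg_le_of_abs_le (abs_real_inner_le_norm (T x + r • T y) (T y)))
            (le_of_abs_le (abs_real_inner_le_norm (T x + r • T y) (T y)))
          nlinarith)
      have hc' : ConvexOn ℝ (Set.Icc (0 : ℝ) 1) fun s => G (x + s • y) := by
        simpa only [hG, map_add, map_smul] using hc
      have := hc'.2 (Set.left_mem_Icc.2 zero_le_one) (Set.right_mem_Icc.2 zero_le_one)
        (sub_nonneg.2 hs.2) hs.1 (by ring)
      simp only [smul_eq_mul, mul_zero, mul_one, zero_add, zero_smul, add_zero, one_smul] at this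
      refine this.trans ?_
      nlinarith [hs.1, hs.2]
    · push Not at hz
      obtain ⟨r, hr, hr0⟩ := hz
      have hx' : x = -(r • y) := eq_neg_of_add_eq_zero_left hr0
      rcases lt_or_ge s r with hsr | hsr
      · have hr' : 0 < r := hs.1.trans_lt hsr
        have : x + s • y = (1 - s / r) • x := by
          rw [hx', ← sub_eq_zero]
          match_scalars
          field_simp
          ring
        rw [this]
        refine hstar x hx _ ⟨?_, ?_⟩
        · rw [sub_nonneg, div_le_one hr']
          exact hsr.le
        · linarith [div_nonneg hs.1 hr'.le]
      · rcases hr.2.lt_or_eq with hr1 | rfl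
        · have hr' : 0 < 1 - r := sub_pos.2 hr1
          have : x + s • y = ((s - r) / (1 - r)) • (x + y) := by
            rw [hx', ← sub_eq_zero]
            match_scalars
            field_simp
            ring
          rw [this]
          refine hstar _ hy _ ⟨div_nonneg (sub_nonneg.2 hsr) hr'.le, ?_⟩
          rw [div_le_one hr']
          linarith [hs.2]
        · have : s = 1 := le_antisymm hs.2 hsr
          rw [this, one_smul]
          exact hy
  intro x hx y hy a b ha hb hab
  have := key x (y - x) hx (by simpa using hy) b ⟨hb, by linarith⟩
  have e : a • x + b • y = x + b • (y - x) := by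
    rw [← eq_sub_of_add_eq hab |>.symm]
    module
  change G _ ≤ 1
  rwa [e]

end

/-! ### Complex dimension two: section volumes force inclusion. -/

lemma complexHyperbolicVolume_lt_top {m : ℕ} {E : Type*} [NormedAddCommGroup E]
    [InnerProductSpace ℝ E] [FiniteDimensional ℝ E] [MeasurableSpace E] [BorelSpace E]
    {A : Set E} (hA : IsCompact A) (hsub : A ⊆ ball 0 1) :
    complexHyperbolicVolume m E A < ⊤ := by
  rw [complexHyperbolicVolume, withDensity_apply _ hA.measurableSet,
    Measure.restrict_restrict hA.measurableSet, Set.inter_eq_left.2 hsub]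
  have hc : ContinuousOn (fun x : E => (8 : ℝ) ^ m / (1 - ‖x‖ ^ 2) ^ (m + 1)) A := by
    refine ContinuousOn.div (by fun_prop) (by fun_prop) fun x hx => pow_ne_zero _ ?_
    have := mem_ball_zero_iff.1 (hsub hx)
    nlinarith [norm_nonneg x]
  exact (hc.integrableOn_compact hA).lintegral_lt_top

lemma complexHyperbolicVolume_pos {m : ℕ} {E : Type*} [NormedAddCommGroup E]
    [InnerProductSpace ℝ E] [FiniteDimensional ℝ E] [MeasurableSpace E] [BorelSpace E]
    {U : Set E} (hU : IsOpen U) (hne : U.Nonempty) (hsub : U ⊆ ball 0 1) :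
    0 < complexHyperbolicVolume m E U := by
  rw [complexHyperbolicVolume, withDensity_apply _ hU.measurableSet,
    Measure.restrict_restrict hU.measurableSet, Set.inter_eq_left.2 hsub,
    setLIntegral_pos_iff (by fun_prop)]
  refine (hU.measure_pos volume hne).trans_le (measure_mono fun x hx => ⟨?_, hx⟩)
  have := mem_ball_zero_iff.1 (hsub hx)
  have h : 0 < 1 - ‖x‖ ^ 2 := by nlinarith [norm_nonneg x]
  simp only [Function.mem_support, ne_eq, ENNReal.ofReal_eq_zero, not_le]
  positivity

namespace IsInvariantBodyInBall

variable {n : ℕ} {K : ConvexBody (EuclideanSpace ℂ (Fin n))}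

/-- An invariant body contains, with `y`, the disc of radius `‖y‖` of the complex line of `y`. -/
lemma smul_mem (hK : IsInvariantBodyInBall K) {c : ℂ} (hc : ‖c‖ ≤ 1)
    {y : EuclideanSpace ℂ (Fin n)} (hy : y ∈ (K : Set (EuclideanSpace ℂ (Fin n)))) :
    c • y ∈ (K : Set (EuclideanSpace ℂ (Fin n))) := by
  have hnhds : (K : Set (EuclideanSpace ℂ (Fin n))) ∈ nhds 0 :=
    mem_interior_iff_mem_nhds.1 hK.zero_mem_interior
  have hiff : ∀ x, gauge (K : Set (EuclideanSpace ℂ (Fin n))) x ≤ 1 ↔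
      x ∈ (K : Set (EuclideanSpace ℂ (Fin n))) := fun x => by
    rw [gauge_le_one_iff_mem_closure K.convex hnhds, K.isCompact.isClosed.closure_eq]
  obtain ⟨θ, hθ, hcθ⟩ : ∃ θ ∈ Set.Icc (0 : ℝ) (2 * Real.pi),
      c = (‖c‖ : ℂ) * Complex.exp (θ * Complex.I) := by
    rcases le_or_gt 0 c.arg with h | h
    · exact ⟨c.arg, ⟨h, by linarith [Complex.arg_le_pi c, Real.pi_pos]⟩,
        (Complex.norm_mul_exp_arg_mul_I c).symm⟩
    -- Invariance is assumed for angles in `[0, 2π]` only, so a negative argument is shifted by a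
    -- full turn.
    · refine ⟨c.arg + 2 * Real.pi, ⟨by linarith [Complex.neg_pi_lt_arg c, Real.pi_pos],
        by linarith⟩, ?_⟩
      push_cast
      rw [add_mul, Complex.exp_add, Complex.exp_two_pi_mul_I, mul_one,
        Complex.norm_mul_exp_arg_mul_I]
  have hrot : Complex.exp (θ * Complex.I) • y ∈ (K : Set (EuclideanSpace ℂ (Fin n))) := by
    rw [← hiff, hK.rotation_invariant θ hθ, hiff]
    exact hy
  have := K.convex.smul_mem_of_zero_mem (mem_of_mem_nhds hnhds) hrot ⟨norm_nonneg c, hc⟩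
  rw [hcθ, mul_smul]
  exact_mod_cast this

end IsInvariantBodyInBall

/-- In `ℂ²` the orthogonal complement of a nonzero vector is a complex line, so a unit vector
orthogonal to `x` cuts out precisely the line of `x`. -/
lemma exists_unit_orthogonal_line (x : EuclideanSpace ℂ (Fin 2)) (hx : x ≠ 0) :
    ∃ ξ : EuclideanSpace ℂ (Fin 2), ‖ξ‖ = 1 ∧ x ∈ complexHyperplane ξ ∧
      ∀ y ∈ complexHyperplane ξ, ∃ c : ℂ, y = c • x := by
  have hfr : Module.finrank ℂ (EuclideanSpace ℂ (Fin 2)) = 1 + 1 := by simp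
  have : Fact (Module.finrank ℂ (EuclideanSpace ℂ (Fin 2)) = 1 + 1) := ⟨hfr⟩
  have h1 := Submodule.finrank_orthogonal_span_singleton (𝕜 := ℂ) (n := 1) hx
  obtain ⟨v, hv, hv0⟩ := Submodule.exists_mem_ne_zero_of_ne_bot
    (p := (ℂ ∙ x)ᗮ) (by intro h; rw [h] at h1; simp at h1)
  refine ⟨(‖v‖ : ℂ)⁻¹ • v, ?_, ?_, ?_⟩
  · simp [norm_smul, hv0]
  · change x ∈ (Submodule.span ℂ _)ᗮ
    rw [Submodule.mem_orthogonal_singleton_iff_inner_left, inner_smul_right,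
      Submodule.mem_orthogonal_singleton_iff_inner_right.1 hv, mul_zero]
  · intro y hy
    have hw : (‖v‖ : ℂ)⁻¹ • v ≠ 0 := by simp [hv0]
    have h2 := Submodule.finrank_orthogonal_span_singleton (𝕜 := ℂ) (n := 1) hw
    have hxm : x ∈ (ℂ ∙ ((‖v‖ : ℂ)⁻¹ • v))ᗮ := by
      rw [Submodule.mem_orthogonal_singleton_iff_inner_left, inner_smul_right,
        Submodule.mem_orthogonal_singleton_iff_inner_right.1 hv, mul_zero]
    obtain ⟨c, hc⟩ := exists_smul_eq_of_finrank_eq_one h2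
      (x := ⟨x, hxm⟩) (by simpa using hx) ⟨y, hy⟩
    exact ⟨c, by simpa using (congrArg Subtype.val hc).symm⟩

/-- In complex dimension two, the sections determine the inclusion relation. -/
lemma subset_of_sectionHVol_le {K L : ConvexBody (EuclideanSpace ℂ (Fin 2))}
    (hK : IsInvariantBodyInBall K) (hL : IsInvariantBodyInBall L)
    (h : ∀ ξ : EuclideanSpace ℂ (Fin 2), ‖ξ‖ = 1 →
      sectionHVol (K : Set (EuclideanSpace ℂ (Fin 2))) ξ ≤
        sectionHVol (L : Set (EuclideanSpace ℂ (Fin 2))) ξ) :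
    (K : Set (EuclideanSpace ℂ (Fin 2))) ⊆ L := by
  intro x hxK
  by_contra hxL
  have hx0 : x ≠ 0 := by
    rintro rfl
    exact hxL (interior_subset hL.zero_mem_interior)
  have hxn : 0 < ‖x‖ := norm_pos_iff.2 hx0
  obtain ⟨ξ, hξ, hxξ, hline⟩ := exists_unit_orthogonal_line x hx0
  refine (h ξ hξ).not_gt ?_
  have hcl : IsClosed {y : complexHyperplane ξ |
      (y : EuclideanSpace ℂ (Fin 2)) ∈ (L : Set (EuclideanSpace ℂ (Fin 2)))} :=
    L.isCompact.isClosed.preimage continuous_subtype_val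
  have hball : {y : complexHyperplane ξ |
      (y : EuclideanSpace ℂ (Fin 2)) ∈ (L : Set (EuclideanSpace ℂ (Fin 2)))} ⊆ ball 0 1 := by
    intro y hy
    simpa using hL.subset_ball hy
  have hcpt := Metric.isCompact_of_isClosed_isBounded hcl (isBounded_ball.subset hball)
  have hLx : ∀ y : complexHyperplane ξ, (y : EuclideanSpace ℂ (Fin 2)) ∈
      (L : Set (EuclideanSpace ℂ (Fin 2))) → ‖y‖ < ‖x‖ := by
    intro y hy
    by_contra! hle
    obtain ⟨c, hc⟩ := hline y y.2
    have hyn : ‖y‖ = ‖c‖ * ‖x‖ := by rw [← norm_smul, ← hc]; rfl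
    have hc1 : 1 ≤ ‖c‖ := by
      by_contra! hlt
      nlinarith
    have hc0 : c ≠ 0 := by
      rintro rfl
      norm_num at hc1
    apply hxL
    have := hL.smul_mem (c := c⁻¹) (by rw [norm_inv]; exact inv_le_one_of_one_le₀ hc1) hy
    rwa [hc, smul_smul, inv_mul_cancel₀ hc0, one_smul] at this
  have hKx : ∀ y : complexHyperplane ξ, ‖y‖ ≤ ‖x‖ → (y : EuclideanSpace ℂ (Fin 2)) ∈
      (K : Set (EuclideanSpace ℂ (Fin 2))) := by
    intro y hy
    obtain ⟨c, hc⟩ := hline y y.2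
    have hyn : ‖y‖ = ‖c‖ * ‖x‖ := by rw [← norm_smul, ← hc]; rfl
    rw [hc]
    refine hK.smul_mem ?_ hxK
    by_contra! hlt
    nlinarith
  -- The part of the disc of radius `‖x‖` outside the section of `L` is open, and nonempty since
  -- otherwise the closed section would contain `x`. Its positive volume, added to the finite volume
  -- of the section of `L`, still fits in the section of `K`.
  have hopen := isOpen_ball (x := (0 : complexHyperplane ξ)) (ε := ‖x‖) |>.sdiff hcl
  have hxball : ‖x‖ < 1 := by simpa using hK.subset_ball hxK
  have hne : (ball (0 : complexHyperplane ξ) ‖x‖ \ {y : complexHyperplane ξ |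
      (y : EuclideanSpace ℂ (Fin 2)) ∈ (L : Set (EuclideanSpace ℂ (Fin 2)))}).Nonempty := by
    rw [Set.nonempty_iff_ne_empty]
    intro hemp
    have hsub := closure_minimal (Set.sdiff_eq_empty.1 hemp) hcl
    rw [closure_ball _ hxn.ne'] at hsub
    exact hxL (hsub (a := ⟨x, hxξ⟩) (by simp))
  calc sectionHVol (L : Set (EuclideanSpace ℂ (Fin 2))) ξ
      < sectionHVol (L : Set (EuclideanSpace ℂ (Fin 2))) ξ +
        complexHyperbolicVolume (2 - 1) (complexHyperplane ξ)
          (ball (0 : complexHyperplane ξ) ‖x‖ \ {y : complexHyperplane ξ |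
            (y : EuclideanSpace ℂ (Fin 2)) ∈ (L : Set (EuclideanSpace ℂ (Fin 2)))}) :=
        ENNReal.lt_add_right (complexHyperbolicVolume_lt_top hcpt hball).ne
          (complexHyperbolicVolume_pos hopen hne
            (Set.sdiff_subset.trans (ball_subset_ball hxball.le))).ne'
    _ = complexHyperbolicVolume (2 - 1) (complexHyperplane ξ) _ :=
        (measure_union Set.disjoint_sdiff_right hopen.measurableSet).symm
    _ ≤ sectionHVol (K : Set (EuclideanSpace ℂ (Fin 2))) ξ := by
        refine measure_mono ?_
        rintro y (hy | hy)
        · exact hKx y (hLx y hy).le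
        · exact hKx y (mem_ball_zero_iff.1 hy.1).le

/-! ### Moments on sections and bodies with prescribed volumes. -/

/-- A linear functional of norm at most one has normalized second moment at most `1 / dim E` on
the sphere. -/
lemma integral_sphere_sq_le {E : Type*} [NormedAddCommGroup E] [InnerProductSpace ℝ E]
    [FiniteDimensional ℝ E] [MeasurableSpace E] [BorelSpace E] (f : E →L[ℝ] ℝ)
    (hf : ∀ x, |f x| ≤ ‖x‖) :
    Module.finrank ℝ E * ∫ θ : sphere (0 : E) 1, f θ ^ 2 ∂sphereMeasure E ≤
      (sphereMeasure E).real Set.univ := by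
  have h := integral_sphere_inner_sq ((InnerProductSpace.toDual ℝ E).symm f)
  simp only [InnerProductSpace.toDual_symm_apply] at h
  rw [h, LinearIsometryEquiv.norm_map]
  have hn : ‖f‖ ≤ 1 := f.opNorm_le_bound zero_le_one fun x => by simpa using hf x
  have : ‖f‖ ^ 2 ≤ 1 := pow_le_one₀ (norm_nonneg _) hn
  exact mul_le_of_le_one_left measureReal_nonneg this

section

variable {n : ℕ}

lemma finrank_complexHyperplane {ξ : EuclideanSpace ℂ (Fin n)} (hξ : ξ ≠ 0) :
    Module.finrank ℝ (complexHyperplane ξ) = 2 * (n - 1) := by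
  have hn : n ≠ 0 := by
    rintro rfl
    exact hξ (Subsingleton.elim _ _)
  obtain ⟨k, rfl⟩ := Nat.exists_eq_succ_of_ne_zero hn
  have : Fact (Module.finrank ℂ (EuclideanSpace ℂ (Fin (k + 1))) = k + 1) := ⟨by simp⟩
  have h := Submodule.finrank_orthogonal_span_singleton (𝕜 := ℂ) (n := k) hξ
  have h' : Module.finrank ℝ (complexHyperplane ξ) = 2 * Module.finrank ℂ (ℂ ∙ ξ)ᗮ := by
    rw [← finrank_real_of_complex]
    rfl
  rw [h', h, Nat.succ_sub_one]

/-- The real and imaginary parts of the coordinate are real functionals of norm at most one on a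
space of real dimension `2 * (n - 1)`; each contributes at most half of the bound. -/
lemma integral_section_coord_le {ξ : EuclideanSpace ℂ (Fin n)} (hξ : ξ ≠ 0) (i : Fin n) :
    (n - 1 : ℕ) * ∫ θ : sphere (0 : complexHyperplane ξ) 1,
        ‖((θ : complexHyperplane ξ) : EuclideanSpace ℂ (Fin n)) i‖ ^ 2
        ∂sphereMeasure (complexHyperplane ξ) ≤
      (sphereMeasure (complexHyperplane ξ)).real Set.univ := by
  let p : complexHyperplane ξ →L[ℝ] ℂ :=
    ((EuclideanSpace.proj i : EuclideanSpace ℂ (Fin n) →L[ℂ] ℂ).restrictScalars ℝ).comp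
      (complexHyperplane ξ).subtypeL
  have hp : ∀ x, ‖p x‖ ≤ ‖x‖ := fun x => PiLp.norm_apply_le (x : EuclideanSpace ℂ (Fin n)) i
  have h1 := integral_sphere_sq_le (Complex.reCLM.comp p)
    fun x => (Complex.abs_re_le_norm _).trans (hp x)
  have h2 := integral_sphere_sq_le (Complex.imCLM.comp p)
    fun x => (Complex.abs_im_le_norm _).trans (hp x)
  have hsum : ∫ θ : sphere (0 : complexHyperplane ξ) 1,
        ‖((θ : complexHyperplane ξ) : EuclideanSpace ℂ (Fin n)) i‖ ^ 2
        ∂sphereMeasure (complexHyperplane ξ) =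
      ∫ θ : sphere (0 : complexHyperplane ξ) 1, (Complex.reCLM.comp p) θ ^ 2
        ∂sphereMeasure (complexHyperplane ξ) +
      ∫ θ : sphere (0 : complexHyperplane ξ) 1, (Complex.imCLM.comp p) θ ^ 2
        ∂sphereMeasure (complexHyperplane ξ) := by
    rw [← integral_add (integrable_sphere (by fun_prop)) (integrable_sphere (by fun_prop))]
    refine integral_congr_ae (.of_forall fun θ => ?_)
    simp only [Complex.sq_norm, Complex.normSq_apply]
    simp only [ContinuousLinearMap.comp_apply, Complex.reCLM_apply, Complex.imCLM_apply, sq]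
    rfl
  rw [finrank_complexHyperplane hξ] at h1 h2
  rw [Nat.cast_mul, Nat.cast_ofNat] at h1 h2
  rw [hsum]
  linarith

/-- The `C²` size of `φ` is bounded on the compact interval, so scaling supplies the smallness that
the convexity criterion needs. -/
lemma exists_small_C2 {φ : ℝ → ℝ} {U : Set ℝ} (hU : IsOpen U) (hIU : Set.Icc (0 : ℝ) 1 ⊆ U)
    (hφ : ContDiffOn ℝ 2 φ U) : ∃ ε₀ > 0, ∀ ε, 0 < ε → ε ≤ ε₀ → ∃ φ' φ'' : ℝ → ℝ,
      (∀ t ∈ Set.Icc (0 : ℝ) 1, HasDerivAt (fun t => ε * φ t) (φ' t) t) ∧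
      (∀ t ∈ Set.Icc (0 : ℝ) 1, HasDerivAt φ' (φ'' t) t) ∧
      ∀ t ∈ Set.Icc (0 : ℝ) 1, |ε * φ t| + |φ' t| + 8 * |φ'' t| ≤ 1 := by
  have hd : ContDiffOn ℝ 1 (deriv φ) U := hφ.deriv_of_isOpen hU (by norm_num)
  have hdd : ContDiffOn ℝ 0 (deriv (deriv φ)) U := hd.deriv_of_isOpen hU (by norm_num)
  obtain ⟨C, hC⟩ := isCompact_Icc.exists_bound_of_continuousOn
    (f := fun t => |φ t| + |deriv φ t| + 8 * |deriv (deriv φ) t|) (s := Set.Icc (0 : ℝ) 1)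
    ((((hφ.continuousOn.abs).add hd.continuousOn.abs).add
      (hdd.continuousOn.abs.const_mul 8)).mono hIU)
  refine ⟨1 / (|C| + 1), by positivity, fun ε hε hε0 => ⟨fun t => ε * deriv φ t,
    fun t => ε * deriv (deriv φ) t, fun t ht => ?_, fun t ht => ?_, fun t ht => ?_⟩⟩
  · exact ((hφ.differentiableOn (by norm_num)).differentiableAt
      (hU.mem_nhds (hIU ht))).hasDerivAt.const_mul ε
  · exact ((hd.differentiableOn (by norm_num)).differentiableAt
      (hU.mem_nhds (hIU ht))).hasDerivAt.const_mul ε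
  · rw [le_div_iff₀ (by positivity)] at hε0
    have h := (le_abs_self _).trans ((hC t ht).trans (le_abs_self C))
    simp only [abs_mul, abs_of_pos hε]
    nlinarith

/-- The origin is no exception, since there the ratio is `0 / 0 = 0`. -/
lemma coord_ratio_mem_Icc (i : Fin n) (x : EuclideanSpace ℂ (Fin n)) :
    ‖x i‖ ^ 2 / ‖x‖ ^ 2 ∈ Set.Icc (0 : ℝ) 1 :=
  ⟨by positivity, div_le_one_of_le₀
    (pow_le_pow_left₀ (norm_nonneg _) (PiLp.norm_apply_le x i) 2) (by positivity)⟩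

/-- The body with squared gauge `‖x‖ ^ 2 * (1 + φ (‖x i‖ ^ 2 / ‖x‖ ^ 2))`. -/
lemma exists_convexBody {φ φ' φ'' : ℝ → ℝ} (i : Fin n)
    (h1 : ∀ t ∈ Set.Icc (0 : ℝ) 1, HasDerivAt φ (φ' t) t)
    (h2 : ∀ t ∈ Set.Icc (0 : ℝ) 1, HasDerivAt φ' (φ'' t) t)
    (hsmall : ∀ t ∈ Set.Icc (0 : ℝ) 1, |φ t| + |φ' t| + 8 * |φ'' t| ≤ 1)
    (hpos : ∀ t ∈ Set.Icc (0 : ℝ) 1, 0 < φ t) :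
    ∃ K : ConvexBody (EuclideanSpace ℂ (Fin n)), IsInvariantBodyInBall K ∧
      (K : Set (EuclideanSpace ℂ (Fin n))) =
        {x | ‖x‖ ^ 2 * (1 + φ (‖x i‖ ^ 2 / ‖x‖ ^ 2)) ≤ 1} := by
  set G : EuclideanSpace ℂ (Fin n) → ℝ := fun x => ‖x‖ ^ 2 * (1 + φ (‖x i‖ ^ 2 / ‖x‖ ^ 2)) with hG
  have hle : ∀ x, G x ≤ ‖x‖ ^ 2 * 2 := by
    intro x
    have := hsmall _ (coord_ratio_mem_Icc i x)
    have h3 := le_abs_self (φ (‖x i‖ ^ 2 / ‖x‖ ^ 2))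
    have h4 := abs_nonneg (φ' (‖x i‖ ^ 2 / ‖x‖ ^ 2))
    have h5 := abs_nonneg (φ'' (‖x i‖ ^ 2 / ‖x‖ ^ 2))
    exact mul_le_mul_of_nonneg_left (by linarith) (by positivity)
  have hge : ∀ x, ‖x‖ ^ 2 ≤ G x := by
    intro x
    have := hpos _ (coord_ratio_mem_Icc i x)
    exact le_mul_of_one_le_right (by positivity) (by linarith)
  have hcont : Continuous G := by
    rw [continuous_iff_continuousAt]
    intro x
    -- The ratio may be discontinuous at the origin, but `G` is squeezed there between `0` and `‖x‖
    -- ^ 2 * 2`.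
    rcases eq_or_ne x 0 with rfl | hx
    · have h0 : G 0 = 0 := by simp [hG]
      rw [ContinuousAt, h0]
      refine squeeze_zero (fun x => (sq_nonneg _).trans (hge x)) hle ?_
      have : Continuous fun x : EuclideanSpace ℂ (Fin n) => ‖x‖ ^ 2 * 2 := by fun_prop
      simpa using this.tendsto 0
    · have hx' : ‖x‖ ^ 2 ≠ 0 := by simpa using hx
      have hr : ContinuousAt (fun x : EuclideanSpace ℂ (Fin n) => ‖x i‖ ^ 2 / ‖x‖ ^ 2) x :=
        ContinuousAt.div (by fun_prop) (by fun_prop) hx'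
      have hc := ContinuousAt.comp (f := fun x : EuclideanSpace ℂ (Fin n) => ‖x i‖ ^ 2 / ‖x‖ ^ 2)
        (h1 _ (coord_ratio_mem_Icc i x)).continuousAt hr
      exact ContinuousAt.mul (by fun_prop) (continuousAt_const.add hc)
  have hconv : Convex ℝ {x | G x ≤ 1} :=
    convex_setOf_norm_sq_mul_le h1 h2 hsmall
      ((EuclideanSpace.proj i : EuclideanSpace ℂ (Fin n) →L[ℂ] ℂ).restrictScalars ℝ).toLinearMap
      fun x => PiLp.norm_apply_le x i
  have hball : {x | G x ≤ 1} ⊆ ball 0 1 := by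
    intro x hx
    have hx' : ‖x‖ ^ 2 * (1 + φ (‖x i‖ ^ 2 / ‖x‖ ^ 2)) ≤ 1 := hx
    have := hpos _ (coord_ratio_mem_Icc i x)
    rw [mem_ball_zero_iff]
    by_contra! h
    nlinarith [mul_le_mul h h zero_le_one (norm_nonneg x)]
  have hcpt : IsCompact {x | G x ≤ 1} :=
    isCompact_of_isClosed_isBounded (isClosed_le hcont continuous_const)
      (isBounded_ball.subset hball)
  let K : ConvexBody (EuclideanSpace ℂ (Fin n)) := ⟨{x | G x ≤ 1}, hconv, hcpt, ⟨0, by simp [hG]⟩⟩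
  have hK : (K : Set (EuclideanSpace ℂ (Fin n))) = {x | G x ≤ 1} := rfl
  refine ⟨K, ⟨?_, ?_, hball⟩, rfl⟩
  · rw [hK]
    refine interior_mono (s := {x | G x < 1}) (fun x (hx : G x < 1) => hx.le) ?_
    rw [(isOpen_lt hcont continuous_const).interior_eq]
    simp [hG]
  · intro θ _ x
    have hc : ‖Complex.exp (θ * Complex.I)‖ = 1 := Complex.norm_exp_ofReal_mul_I θ
    have hrot : ∀ y : EuclideanSpace ℂ (Fin n),
        Complex.exp (θ * Complex.I) • y ∈ (K : Set (EuclideanSpace ℂ (Fin n))) ↔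
          y ∈ (K : Set (EuclideanSpace ℂ (Fin n))) := by
      intro y
      have : G (Complex.exp (θ * Complex.I) • y) = G y := by
        simp only [hG, norm_smul, hc, PiLp.smul_apply, one_mul]
      change G _ ≤ 1 ↔ G _ ≤ 1
      rw [this]
    simp only [gauge_def', smul_comm _ (Complex.exp (θ * Complex.I)) x, hrot]

/-- Bodies with prescribed hyperbolic radial function: the volumes of the body and of its sections
are, up to factors independent of `W`, integrals of powers of `W` over the spheres. -/
lemma exists_convexBody_volumes {m : ℕ} (hm : 1 ≤ m) (hn : n = m + 1) (i : Fin n) {W : ℝ → ℝ}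
    (hW : ContDiff ℝ 2 W) (hpos : ∀ t ∈ Set.Icc (0 : ℝ) 1, 0 < W t) :
    ∃ ε₀ > 0, ∀ ε, 0 < ε → ε ≤ ε₀ → ∃ K : ConvexBody (EuclideanSpace ℂ (Fin n)),
      IsInvariantBodyInBall K ∧
      (∀ ξ : EuclideanSpace ℂ (Fin n), ‖ξ‖ = 1 →
        sectionHVol (K : Set (EuclideanSpace ℂ (Fin n))) ξ =
          ENNReal.ofReal (8 ^ m / (2 * m) * ε⁻¹ ^ m * ∫ θ : sphere (0 : complexHyperplane ξ) 1,
            W (‖((θ : complexHyperplane ξ) : EuclideanSpace ℂ (Fin n)) i‖ ^ 2)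
            ∂sphereMeasure (complexHyperplane ξ))) ∧
      HVol (K : Set (EuclideanSpace ℂ (Fin n))) =
        ENNReal.ofReal (8 ^ n / (2 * n) * ε⁻¹ ^ n *
          ∫ θ : sphere (0 : EuclideanSpace ℂ (Fin n)) 1,
            W (‖(θ : EuclideanSpace ℂ (Fin n)) i‖ ^ 2) ^ ((n : ℝ) / m)
            ∂sphereMeasure (EuclideanSpace ℂ (Fin n))) := by
  have hm0 : (m : ℝ) ≠ 0 := by positivity
  have hU : IsOpen {t | 0 < W t} := isOpen_lt continuous_const hW.continuous
  -- The exponent is chosen so that `φ ^ (-m) = W` on sections and `φ ^ (-n) = W ^ (n/m)` on the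
  -- whole sphere.
  have hφ : ContDiffOn ℝ 2 (fun t => W t ^ (-(1 / m : ℝ))) {t | 0 < W t} :=
    hW.contDiffOn.rpow_const_of_ne fun t ht => ne_of_gt ht
  have hmeas : Measurable fun t => W t ^ (-(1 / m : ℝ)) := hW.continuous.measurable.pow_const _
  obtain ⟨ε₀, hε₀, hε⟩ := exists_small_C2 hU hpos hφ
  refine ⟨ε₀, hε₀, fun ε he hle => ?_⟩
  obtain ⟨φ', φ'', h1, h2, hsmall⟩ := hε ε he hle
  have hφpos : ∀ t ∈ Set.Icc (0 : ℝ) 1, 0 < ε * W t ^ (-(1 / m : ℝ)) := fun t ht =>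
    mul_pos he (Real.rpow_pos_of_pos (hpos t ht) _)
  obtain ⟨K, hK, hKeq⟩ := exists_convexBody i h1 h2 hsmall hφpos
  have hpow : ∀ t ∈ Set.Icc (0 : ℝ) 1, ∀ k : ℕ,
      (ε * W t ^ (-(1 / m : ℝ)))⁻¹ ^ k = ε⁻¹ ^ k * W t ^ ((k : ℝ) / m) := by
    intro t ht k
    rw [mul_inv, mul_pow, ← Real.rpow_neg (hpos t ht).le, ← Real.rpow_natCast (W t ^ _) k,
      ← Real.rpow_mul (hpos t ht).le]
    congr 2
    ring
  refine ⟨K, hK, fun ξ hξ => ?_, ?_⟩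
  · have hξ0 : ξ ≠ 0 := by
      rintro rfl
      simp at hξ
    have hv := complexHyperbolicVolume_star hm (E := complexHyperplane ξ)
      (φ := fun x => ε * W (‖(x : EuclideanSpace ℂ (Fin n)) i‖ ^ 2 / ‖x‖ ^ 2) ^ (-(1 / m : ℝ)))
      (by rw [finrank_complexHyperplane hξ0, hn, Nat.add_sub_cancel])
      (measurable_const.mul (hmeas.comp (by fun_prop)))
      (fun x => hφpos _ (coord_ratio_mem_Icc i (x : EuclideanSpace ℂ (Fin n))))
      (fun r x hr => by
        simp only [Submodule.coe_smul, PiLp.smul_apply, norm_smul, mul_pow]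
        rw [mul_div_mul_left _ _ (by simpa using hr.ne')])
    rw [sectionHVol, hKeq, show n - 1 = m by omega]
    refine hv.trans ?_
    rw [← integral_const_mul, ofReal_integral_eq_lintegral_ofReal]
    · refine lintegral_congr fun θ => ?_
      have hθ : ‖(θ : complexHyperplane ξ)‖ = 1 := by simp
      have hmem := coord_ratio_mem_Icc i ((θ : complexHyperplane ξ) : EuclideanSpace ℂ (Fin n))
      rw [← Submodule.coe_norm, hθ] at hmem
      rw [hθ, hpow _ hmem, div_self hm0, Real.rpow_one]
      simp [mul_assoc]
    · exact (integrable_sphere (hW.continuous.comp (by fun_prop))).const_mul _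
    · refine .of_forall fun θ => ?_
      have hθ : ‖(θ : complexHyperplane ξ)‖ = 1 := by simp
      have hmem := coord_ratio_mem_Icc i ((θ : complexHyperplane ξ) : EuclideanSpace ℂ (Fin n))
      rw [← Submodule.coe_norm, hθ, one_pow, div_one] at hmem
      have := hpos _ hmem
      simp only [Pi.zero_apply]
      positivity
  · have hv := complexHyperbolicVolume_star (m := n) (by omega) (E := EuclideanSpace ℂ (Fin n))
      (φ := fun x => ε * W (‖x i‖ ^ 2 / ‖x‖ ^ 2) ^ (-(1 / m : ℝ)))
      (by rw [finrank_real_of_complex]; simp)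
      (measurable_const.mul (hmeas.comp (by fun_prop)))
      (fun x => hφpos _ (coord_ratio_mem_Icc i x))
      (fun r x hr => by
        simp only [PiLp.smul_apply, norm_smul, mul_pow]
        rw [mul_div_mul_left _ _ (by simpa using hr.ne')])
    rw [HVol, hKeq]
    refine hv.trans ?_
    have hmem : ∀ θ : sphere (0 : EuclideanSpace ℂ (Fin n)) 1,
        ‖(θ : EuclideanSpace ℂ (Fin n)) i‖ ^ 2 ∈ Set.Icc (0 : ℝ) 1 := by
      intro θ
      have hθ : ‖(θ : EuclideanSpace ℂ (Fin n))‖ = 1 := by simp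
      simpa [hθ] using coord_ratio_mem_Icc i (θ : EuclideanSpace ℂ (Fin n))
    rw [← integral_const_mul, ofReal_integral_eq_lintegral_ofReal]
    · refine lintegral_congr fun θ => ?_
      have hθ : ‖(θ : EuclideanSpace ℂ (Fin n))‖ = 1 := by simp
      rw [hθ, one_pow, div_one, hpow _ (hmem θ), mul_assoc]
    · refine (integrable_sphere (Continuous.rpow_const
        (hW.continuous.comp (by fun_prop)) fun θ => Or.inl (hpos _ (hmem θ)).ne')).const_mul _
    · refine .of_forall fun θ => ?_
      have := hpos _ (hmem θ)
      simp only [Pi.zero_apply]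
      positivity

end

/-! ### The weight and the counterexample in dimension at least three. -/

/-- Bernoulli's inequality at a general base point. -/
lemma rpow_add_mul_sub_le_rpow {p x y : ℝ} (hp : 1 ≤ p) (hx : 0 < x) (hy : 0 < y) :
    y ^ p + p * y ^ (p - 1) * (x - y) ≤ x ^ p := by
  have hb := one_add_mul_self_le_rpow_one_add (s := x / y - 1) (p := p)
    (by linarith [div_pos hx hy]) hp
  rw [add_sub_cancel, Real.div_rpow hx.le hy.le, le_div_iff₀ (Real.rpow_pos_of_pos hy p)] at hb
  refine le_trans (le_of_eq ?_) hb
  rw [Real.rpow_sub_one hy.ne']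
  field_simp

/-- A positive weight on the sphere, depending on `‖θ i‖` only, against which `m ‖θ i‖ ^ 2 - 1`
has positive integral. -/
lemma exists_weight {n m : ℕ} (hm : 2 ≤ m) (i : Fin n) :
    ∃ (δ : ℝ) (g : ℝ → ℝ), 0 < δ ∧ ContDiff ℝ 2 g ∧ (∀ t, δ ≤ g t) ∧
      0 < ∫ θ : sphere (0 : EuclideanSpace ℂ (Fin n)) 1,
        g (‖(θ : EuclideanSpace ℂ (Fin n)) i‖ ^ 2) *
          (m * ‖(θ : EuclideanSpace ℂ (Fin n)) i‖ ^ 2 - 1)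
        ∂sphereMeasure (EuclideanSpace ℂ (Fin n)) := by
  have hglue : ContDiff ℝ 2 expNegInvGlue := expNegInvGlue.contDiff (n := 2)
  set y : sphere (0 : EuclideanSpace ℂ (Fin n)) 1 → ℝ :=
    fun θ => m * ‖(θ : EuclideanSpace ℂ (Fin n)) i‖ ^ 2 - 1 with hy
  have hyc : Continuous y := by fun_prop
  have hcont : Continuous fun θ => expNegInvGlue (y θ) * y θ :=
    (hglue.continuous.comp hyc).mul hyc
  have hnonneg : 0 ≤ fun θ => expNegInvGlue (y θ) * y θ := by
    intro θ
    rcases le_total (y θ) 0 with h | h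
    · simp [expNegInvGlue.zero_of_nonpos h]
    · exact mul_nonneg (expNegInvGlue.nonneg _) h
  have hJ : 0 < ∫ θ, expNegInvGlue (y θ) * y θ ∂sphereMeasure (EuclideanSpace ℂ (Fin n)) := by
    -- At the `i`-th basis vector `y = m - 1`, which is positive because `m ≥ 2`.
    let e : sphere (0 : EuclideanSpace ℂ (Fin n)) 1 := ⟨EuclideanSpace.single i 1, by simp⟩
    have he : 0 < y e := by
      have : (2 : ℝ) ≤ m := by exact_mod_cast hm
      simp only [hy, e, PiLp.single_apply, if_true, norm_one]
      linarith
    exact hcont.integral_pos_of_hasCompactSupport_nonneg_nonzero (.of_compactSpace _) hnonneg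
      (x := e) (mul_pos (expNegInvGlue.pos_of_pos he) he).ne'
  set J := ∫ θ, expNegInvGlue (y θ) * y θ ∂sphereMeasure (EuclideanSpace ℂ (Fin n)) with hJdef
  set σ := (sphereMeasure (EuclideanSpace ℂ (Fin n))).real Set.univ with hσ
  have hσ0 : 0 ≤ σ := measureReal_nonneg
  -- The glue function alone gives the integral `J > 0` but vanishes for `m * t ≤ 1`. Adding a
  -- constant `δ` makes the weight positive at a cost of at most `δ * σ`, and `δ = J / (σ + 1)`
  -- leaves `J / (σ + 1)`.
  refine ⟨J / (σ + 1), fun t => J / (σ + 1) + expNegInvGlue (m * t - 1), by positivity,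
    contDiff_const.add (hglue.comp (by fun_prop)),
    fun t => le_add_of_nonneg_right (expNegInvGlue.nonneg _), ?_⟩
  have hyge : -σ ≤ ∫ θ, y θ ∂sphereMeasure (EuclideanSpace ℂ (Fin n)) := by
    have := integral_mono (μ := sphereMeasure (EuclideanSpace ℂ (Fin n))) (f := fun _ => (-1 : ℝ))
      (integrable_const _) (integrable_sphere hyc) fun θ => by
        simp only [hy]
        linarith [show 0 ≤ (m : ℝ) * ‖(θ : EuclideanSpace ℂ (Fin n)) i‖ ^ 2 by positivity]
    simpa [hσ] using this
  have hsplit : ∫ θ : sphere (0 : EuclideanSpace ℂ (Fin n)) 1,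
        (J / (σ + 1) + expNegInvGlue (m * ‖(θ : EuclideanSpace ℂ (Fin n)) i‖ ^ 2 - 1)) *
          (m * ‖(θ : EuclideanSpace ℂ (Fin n)) i‖ ^ 2 - 1)
        ∂sphereMeasure (EuclideanSpace ℂ (Fin n)) =
      J / (σ + 1) * (∫ θ, y θ ∂sphereMeasure (EuclideanSpace ℂ (Fin n))) + J := by
    rw [hJdef, ← integral_const_mul, ← integral_add ((integrable_sphere hyc).const_mul _)
      (integrable_sphere hcont)]
    simp only [add_mul, hy]
  rw [hsplit]
  have h1 : J / (σ + 1) * -σ ≤ J / (σ + 1) *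
      ∫ θ, y θ ∂sphereMeasure (EuclideanSpace ℂ (Fin n)) :=
    mul_le_mul_of_nonneg_left hyge (by positivity)
  have h2 : J / (σ + 1) * -σ + J = J / (σ + 1) := by
    field_simp
    ring
  have h3 : 0 < J / (σ + 1) := by positivity
  linarith

/-- The bodies giving a negative answer in complex dimension at least three. -/
lemma exists_counterexample {n : ℕ} (hn : 3 ≤ n) :
    ∃ K L : ConvexBody (EuclideanSpace ℂ (Fin n)),
      IsInvariantBodyInBall K ∧ IsInvariantBodyInBall L ∧
      (∀ ξ : EuclideanSpace ℂ (Fin n), ‖ξ‖ = 1 →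
        sectionHVol (K : Set (EuclideanSpace ℂ (Fin n))) ξ ≤
          sectionHVol (L : Set (EuclideanSpace ℂ (Fin n))) ξ) ∧
      HVol (L : Set (EuclideanSpace ℂ (Fin n))) < HVol (K : Set (EuclideanSpace ℂ (Fin n))) := by
  obtain ⟨m, hm, hnm⟩ : ∃ m, 2 ≤ m ∧ n = m + 1 := ⟨n - 1, by omega, by omega⟩
  have hm0 : (0 : ℝ) < m := by positivity
  let i : Fin n := ⟨0, by omega⟩
  obtain ⟨δ, g, hδ, hg, hδg, hint⟩ := exists_weight (n := n) hm i
  -- For `t ≥ 0` the perturbation lowers `g ^ m ≥ δ ^ m` by at most `l`, so this choice keeps it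
  -- positive.
  set l : ℝ := δ ^ m / 2 with hl
  have hl0 : 0 < l := by positivity
  have hB : ContDiff ℝ 2 fun t => g t ^ m := hg.pow m
  have hA : ContDiff ℝ 2 fun t => g t ^ m + l * (m * t - 1) := hB.add (by fun_prop)
  have hgpos : ∀ t, 0 < g t := fun t => hδ.trans_le (hδg t)
  have hBpos : ∀ t ∈ Set.Icc (0 : ℝ) 1, 0 < g t ^ m := fun t _ => pow_pos (hgpos t) m
  have hApos : ∀ t ∈ Set.Icc (0 : ℝ) 1, 0 < g t ^ m + l * (m * t - 1) := by
    intro t ht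
    have h1 : δ ^ m ≤ g t ^ m := pow_le_pow_left₀ hδ.le (hδg t) m
    have h2 : 0 ≤ l * (m * t) := mul_nonneg hl0.le (mul_nonneg hm0.le ht.1)
    have h3 : δ ^ m = 2 * l := by rw [hl]; ring
    linarith
  obtain ⟨εA, hεA, hKA⟩ := exists_convexBody_volumes (by omega) hnm i hA hApos
  obtain ⟨εB, hεB, hKB⟩ := exists_convexBody_volumes (by omega) hnm i hB hBpos
  -- A common `ε` gives both bodies the same prefactors, leaving only the integrals to compare.
  have hε : 0 < min εA εB := lt_min hεA hεB
  obtain ⟨K, hK, hKs, hKv⟩ := hKA _ hε (min_le_left _ _)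
  obtain ⟨L, hL, hLs, hLv⟩ := hKB _ hε (min_le_right _ _)
  set ε := min εA εB
  have hgc := hg.continuous
  refine ⟨K, L, hK, hL, fun ξ hξ => ?_, ?_⟩
  · have hξ0 : ξ ≠ 0 := by
      rintro rfl
      simp at hξ
    rw [hKs ξ hξ, hLs ξ hξ]
    refine ENNReal.ofReal_le_ofReal (mul_le_mul_of_nonneg_left ?_ (by positivity))
    have hmean := integral_section_coord_le hξ0 i
    rw [show n - 1 = m by omega] at hmean
    have hc : Continuous fun θ : sphere (0 : complexHyperplane ξ) 1 =>
        ‖((θ : complexHyperplane ξ) : EuclideanSpace ℂ (Fin n)) i‖ ^ 2 := by fun_prop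
    have hi := (integrable_sphere hc).const_mul (m : ℝ)
    have hb : Continuous fun θ : sphere (0 : complexHyperplane ξ) 1 =>
        g (‖((θ : complexHyperplane ξ) : EuclideanSpace ℂ (Fin n)) i‖ ^ 2) ^ m := by fun_prop
    have hd : Continuous fun θ : sphere (0 : complexHyperplane ξ) 1 =>
        l * (m * ‖((θ : complexHyperplane ξ) : EuclideanSpace ℂ (Fin n)) i‖ ^ 2 - 1) := by fun_prop
    rw [integral_add (integrable_sphere hb) (integrable_sphere hd),
      integral_const_mul, integral_sub hi (integrable_const _), integral_const_mul]
    have : l * ((m * ∫ θ : sphere (0 : complexHyperplane ξ) 1,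
        ‖((θ : complexHyperplane ξ) : EuclideanSpace ℂ (Fin n)) i‖ ^ 2
        ∂sphereMeasure (complexHyperplane ξ)) -
        ∫ _ : sphere (0 : complexHyperplane ξ) 1, (1 : ℝ)
          ∂sphereMeasure (complexHyperplane ξ)) ≤ 0 := by
      refine mul_nonpos_of_nonneg_of_nonpos hl0.le ?_
      simpa using hmean
    linarith
  · have hmem : ∀ θ : sphere (0 : EuclideanSpace ℂ (Fin n)) 1,
        ‖(θ : EuclideanSpace ℂ (Fin n)) i‖ ^ 2 ∈ Set.Icc (0 : ℝ) 1 := by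
      intro θ
      simpa using coord_ratio_mem_Icc i (θ : EuclideanSpace ℂ (Fin n))
    have hn0 : (0 : ℝ) < n := by
      rw [hnm]
      positivity
    have hp : 1 ≤ (n : ℝ) / m := by
      rw [le_div_iff₀ hm0, hnm]
      push_cast
      linarith
    have hp1 : (n : ℝ) / m - 1 = (m : ℝ)⁻¹ := by
      rw [hnm]
      push_cast
      field_simp
      ring
    have hcoord : Continuous fun θ : sphere (0 : EuclideanSpace ℂ (Fin n)) 1 =>
        ‖(θ : EuclideanSpace ℂ (Fin n)) i‖ ^ 2 := by fun_prop
    have hIB := integrable_sphere (Continuous.rpow_const (hB.continuous.comp hcoord)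
      (p := (n : ℝ) / m) fun θ => Or.inl (hBpos _ (hmem θ)).ne')
    have hIA := integrable_sphere (Continuous.rpow_const (hA.continuous.comp hcoord)
      (p := (n : ℝ) / m) fun θ => Or.inl (hApos _ (hmem θ)).ne')
    have hIg : Integrable (fun θ : sphere (0 : EuclideanSpace ℂ (Fin n)) 1 =>
        n / m * l * (g (‖(θ : EuclideanSpace ℂ (Fin n)) i‖ ^ 2) *
          (m * ‖(θ : EuclideanSpace ℂ (Fin n)) i‖ ^ 2 - 1)))
        (sphereMeasure (EuclideanSpace ℂ (Fin n))) := integrable_sphere (by fun_prop)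
    have hlt := integral_mono (hIB.add hIg) hIA fun θ => by
      -- Tangent line at `g ^ m` for the exponent `n / m = 1 + 1 / m`: the slope is `n / m` times
      -- `(g ^ m) ^ (1/m) = g`, the weight constructed above.
      have hb := rpow_add_mul_sub_le_rpow hp (hApos _ (hmem θ)) (hBpos _ (hmem θ))
      rw [hp1, Real.pow_rpow_inv_natCast (hgpos _).le (by omega)] at hb
      refine le_trans (le_of_eq ?_) hb
      simp only [Pi.add_apply, Function.comp_apply]
      ring
    rw [integral_add' hIB hIg, integral_const_mul] at hlt
    have hgain := mul_pos (mul_pos (div_pos hn0 hm0) hl0) hint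
    have hlt' := (lt_add_of_pos_right _ hgain).trans_le hlt
    have hBnonneg : 0 ≤ ∫ θ : sphere (0 : EuclideanSpace ℂ (Fin n)) 1,
        (g (‖(θ : EuclideanSpace ℂ (Fin n)) i‖ ^ 2) ^ m) ^ ((n : ℝ) / m)
        ∂sphereMeasure (EuclideanSpace ℂ (Fin n)) :=
      integral_nonneg fun θ => Real.rpow_nonneg (hBpos _ (hmem θ)).le _
    rw [hKv, hLv]
    refine (ENNReal.ofReal_lt_ofReal_iff_of_nonneg (by positivity)).2 ?_
    exact mul_lt_mul_of_pos_left hlt' (by positivity)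

theorem theorem4 (n : ℕ) (hn : 2 ≤ n) :
    (n ≤ 2 →
      ∀ K L : ConvexBody (EuclideanSpace ℂ (Fin n)),
        IsInvariantBodyInBall K → IsInvariantBodyInBall L →
        (∀ ξ : EuclideanSpace ℂ (Fin n), ‖ξ‖ = 1 →
          sectionHVol (K : Set (EuclideanSpace ℂ (Fin n))) ξ ≤
            sectionHVol (L : Set (EuclideanSpace ℂ (Fin n))) ξ) →
        HVol (K : Set (EuclideanSpace ℂ (Fin n))) ≤
          HVol (L : Set (EuclideanSpace ℂ (Fin n)))) ∧
    (3 ≤ n →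
      ∃ K L : ConvexBody (EuclideanSpace ℂ (Fin n)),
        IsInvariantBodyInBall K ∧ IsInvariantBodyInBall L ∧
        (∀ ξ : EuclideanSpace ℂ (Fin n), ‖ξ‖ = 1 →
          sectionHVol (K : Set (EuclideanSpace ℂ (Fin n))) ξ ≤
            sectionHVol (L : Set (EuclideanSpace ℂ (Fin n))) ξ) ∧
        HVol (L : Set (EuclideanSpace ℂ (Fin n))) <
          HVol (K : Set (EuclideanSpace ℂ (Fin n)))) := by
  refine ⟨fun h2 K L hK hL hs => ?_, exists_counterexample⟩
  obtain rfl : n = 2 := le_antisymm h2 hn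
  exact measure_mono (subset_of_sectionHVol_le hK hL hs)
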